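/- **Setting.** For each $n$ let $m=m(n)$ be such that $m(n)=O(n^{\alpha})$ for some $\alpha$, let $\mathcal F_n$ be a collection of distributions of $Z=(Y,X_1,\dots,X_m)$, let $\{g_\beta=g_\beta(X_1,\dots,X_m):\beta\in\mathbb R^m\}$ be a parametrized family of predictors, and let $B^n\subseteq\mathbb R^m$. Let $l(\beta,Z)=l(Y,g_\beta(X_1,\dots,X_m))$ be a prediction loss, put $L_F(\beta)=E_F\,l(\beta,Z)$, and for i.i.d. observations $Z^1,\dots,Z^n$ with law $F_n\in\mathcal F_n$ put $L_{\hat F_n}(\beta)=\frac1n\sum_{i=1}^n l(\beta,Z^i)$. Let $\beta^*_{F_n}$ be a minimizer of $L_{F_n}$ over $B^n$ (assumed to exist; if it is not unique, one minimizer satisfying the assumptions below). A sequence of procedures $\hat\beta_n=\hat\beta_n(Z^1,\dots,Z^n)$ is *persistent* with respect to $B^n$ if for every $\varepsilon>0$ $$\sup_{F_n\in\mathcal F_n}P_{F_n}\bigl(L_{F_n}(\hat\beta_n)-L_{F_n}(\beta^*_{F_n})>\varepsilon\bigr)\to0\qquad(n\to\infty).$$ **Theorem 2.** Assume that 1. $l(y,g_\beta(x_1,\dots,x_m))=h_n\bigl(y,\sum_j\beta_jx_j\bigr)$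 for functions $h_n(y,s)$ that are bounded, and uniformly continuous in $s\in\mathbb R$, uniformly in $y$ and $n$ (for instance with $h_n=h$ not depending on $n$); 2. the covariates are bounded: for some constant $M$, $|X_j|\le M$ almost surely for all $j\le m(n)$, all $F_n\in\mathcal F_n$ and all $n$; 3. for all $n$ and $F_n\in\mathcal F_n$, $\beta^*_{F_n}$ has at most $k_n$ nonzero entries, where $k_n=o(n/\log n)$; 4. for some constant $R\ge 0$, $\|\beta^*_{F_n}\|_2\le R$ for all $n$ and $F_n\in\mathcal F_n$ (one may take $R=1$ without loss of generality). Then empirical risk minimization under the $\ell_1$ constraint, $$\tilde\beta_n\in\arg\min\bigl\{L_{\hat F_n}(\beta):\ \|\beta\|_1\le R\sqrt{k_n}\bigr\}$$ (that is, $\|\beta\|_1\le\sqrt{k_n}$ when $R=1$), is well defined, that is, a minimizer exists for all data, and is persistent with respect to $B^n$, for every choice of the minimizers. -/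

import Mathlib

open Filter Topology MeasureTheory

noncomputable section

/-- The `ℓ₁` norm of a vector of coefficients. -/
def l1Norm {m : ℕ} (β : Fin m → ℝ) : ℝ := ∑ j, |β j|

/-- The `ℓ₂` (Euclidean) norm of a vector of coefficients. -/
def l2Norm {m : ℕ} (β : Fin m → ℝ) : ℝ := √(∑ j, β j ^ 2)

/-- The number of active (nonzero) entries of a vector of coefficients. -/
def numActive {m : ℕ} (β : Fin m → ℝ) : ℕ := (Finset.univ.filter fun j => β j ≠ 0).card

/-- A triangular array. At stage `n` one observation is `z = (y, x)` with outcome `y : 𝒴` and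
explanatory variables `x = (x₁, …, x_{m n})`; the predictors are `g n β`, with parameter
`β ∈ ℝ^{m n}`. -/
structure TriangularArray (𝒴 : Type*) [MeasurableSpace 𝒴] where
  /-- the number of explanatory variables (and of parameters) at stage `n` -/
  m : ℕ → ℕ
  /-- the collection of possible distributions of one observation at stage `n` -/
  𝓕 : (n : ℕ) → Set (ProbabilityMeasure (𝒴 × (Fin (m n) → ℝ)))
  /-- the (parameters of the) predictors against which a procedure is compared at stage `n` -/
  B : (n : ℕ) → Set (Fin (m n) → ℝ)
  /-- the parametrized predictors at stage `n` -/
  g : (n : ℕ) → (Fin (m n) → ℝ) → (Fin (m n) → ℝ) → ℝ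
  /-- the prediction loss: `l y p` is the loss of the prediction `p` when the outcome is `y` -/
  l : 𝒴 → ℝ → ℝ
  /-- the loss of each predictor is a measurable function of the observation -/
  measurable_loss : ∀ n β, Measurable fun z : 𝒴 × (Fin (m n) → ℝ) => l z.1 (g n β z.2)

namespace TriangularArray

variable {𝒴 : Type*} [MeasurableSpace 𝒴] (T : TriangularArray 𝒴)

/-- The type of one observation `z = (y, x₁, …, x_{m n})` at stage `n`. -/
abbrev Obs (n : ℕ) : Type _ := 𝒴 × (Fin (T.m n) → ℝ)

/-- The loss `l(β, z) = l(y, g_β(x))`. -/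
def loss (n : ℕ) (β : Fin (T.m n) → ℝ) (z : T.Obs n) : ℝ := T.l z.1 (T.g n β z.2)

/-- The risk `L_F(β) = E_F l(β, Z)`. -/
def risk (n : ℕ) (F : ProbabilityMeasure (T.Obs n)) (β : Fin (T.m n) → ℝ) : ℝ :=
  ∫ z, T.loss n β z ∂(F : Measure (T.Obs n))

/-- The empirical risk `(1/n) ∑ᵢ l(β, Zⁱ)` of the data `z = (Z¹, …, Zⁿ)`. -/
def empiricalRisk (n : ℕ) (z : Fin n → T.Obs n) (β : Fin (T.m n) → ℝ) : ℝ :=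
  (1 / (n : ℝ)) * ∑ i, T.loss n β (z i)

/-- `β` is a best predictor in `B n` under `F`, that is, a minimizer of `L_F` over `B n`. -/
def IsBest (n : ℕ) (F : ProbabilityMeasure (T.Obs n)) (β : Fin (T.m n) → ℝ) : Prop :=
  β ∈ T.B n ∧ ∀ β' ∈ T.B n, T.risk n F β ≤ T.risk n F β'

/-- A sequence of procedures: at stage `n` the data `(Z¹, …, Zⁿ)` are mapped to a parameter. -/
abbrev Procedure : Type _ := (n : ℕ) → (Fin n → T.Obs n) → (Fin (T.m n) → ℝ)

/-- Persistence of the procedures `βhat`, where `βstar n F` is the best predictor in `B n` under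
`F`: for every `ε > 0`,
`sup_{F ∈ 𝓕 n} P_F(L_F(βhat n (Z¹, …, Zⁿ)) - L_F(βstar n F) > ε) → 0`, with `Z¹, …, Zⁿ` i.i.d.
of law `F`. -/
def Persistent (βstar : (n : ℕ) → ProbabilityMeasure (T.Obs n) → (Fin (T.m n) → ℝ))
    (βhat : T.Procedure) : Prop :=
  ∀ ε : ℝ, 0 < ε →
    Tendsto (fun n : ℕ => ⨆ F ∈ T.𝓕 n,
      Measure.pi (fun _ : Fin n => (F : Measure (T.Obs n)))
        {z | ε < T.risk n F (βhat n z) - T.risk n F (βstar n F)}) atTop (𝓝 0)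

/-- The loss `l(y, g_β(x))` is a function `h(y, ∑ βⱼ xⱼ)` which is bounded and uniformly continuous
in its second argument, uniformly in `y` (and in the stage `n`; when the form of the predictors
does not vary with `n`, neither does `h`). -/
def UniformlyContinuousLoss : Prop :=
  ∃ h : ℕ → 𝒴 → ℝ → ℝ,
    (∀ n β x y, T.l y (T.g n β x) = h n y (∑ j, β j * x j)) ∧
    (∃ C : ℝ, ∀ n y s, |h n y s| ≤ C) ∧
    (∀ ε : ℝ, 0 < ε → ∃ δ : ℝ, 0 < δ ∧
      ∀ n y s s', |s - s'| < δ → |h n y s - h n y s'| < ε)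

/-- The explanatory variables are bounded: one constant works for all `j`, `n`, `F ∈ 𝓕 n`. -/
def BoundedCovariates : Prop :=
  ∃ M : ℝ, ∀ n, ∀ F ∈ T.𝓕 n, ∀ᵐ z ∂(F : Measure (T.Obs n)), ∀ j, |z.2 j| ≤ M

/-- `β` minimizes the empirical risk of the data `z` subject to `‖β‖₁ ≤ b`. -/
def IsL1ConstrainedERM (n : ℕ) (z : Fin n → T.Obs n) (b : ℝ) (β : Fin (T.m n) → ℝ) : Prop :=
  l1Norm β ≤ b ∧ ∀ β', l1Norm β' ≤ b → T.empiricalRisk n z β ≤ T.empiricalRisk n z β'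

end TriangularArray

end

/-! By Cauchy–Schwarz on its support, `βstar` lies in the `ℓ₁` ball of radius `b = R√k`, so the
excess risk of the empirical minimizer is at most twice the largest deviation between empirical and
true risk over that ball.

Maurey's method reduces this supremum to finitely many points. Each `β` in the ball is the mean of a
random average of `N` signed vertices (or the centre), with mean-square prediction error at most
`(bM)²/N` at every bounded `x`. A bounded, uniformly continuous loss varies by at most `ε` plus a
multiple of the squared distance (`abs_sub_le_add_mul_sq`), so the loss of `β` is close to a convex
combination of the losses of the averages. The weights do not depend on the observation, so one
combination serves both risks (`abs_empiricalRisk_sub_risk_le`).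

Since `b²` is linear in `k`, `N = A k + 1` suffices with `A` fixed. Hoeffding and a union bound over
`(2m+1)^N` index tuples give a failure probability of order `exp(N log(2m+1) - cn)`, which vanishes
because `N log(2m+1) = O((k + 1) log n) = o(n)`. -/

noncomputable section

/-! ### Maurey sampling in the `ℓ₁` ball -/

/-- The second moment of a sum of `N` independent draws from a centred finite distribution. -/
theorem sum_prod_mul_sq_sum {ι : Type*} [Fintype ι] (w c : ι → ℝ) (hw : ∑ i, w i = 1)
    (hc : ∑ i, w i * c i = 0) (N : ℕ) :
    ∑ J : Fin N → ι, (∏ i, w (J i)) * (∑ i, c (J i)) ^ 2 = N * ∑ i, w i * c i ^ 2 := by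
  induction N with
  | zero => simp
  | succ N ih =>
    have hprod : ∑ J : Fin N → ι, ∏ i, w (J i) = 1 := by
      rw [← Fintype.sum_pow, hw, one_pow]
    rw [← (Fin.consEquiv fun _ : Fin (N + 1) => ι).sum_comp, Fintype.sum_prod_type]
    simp only [Fin.consEquiv_apply, Fin.prod_univ_succ, Fin.sum_univ_succ, Fin.cons_zero,
      Fin.cons_succ]
    -- The cross term carries the factor `∑ w c = 0`, so variances add.
    have expand : ∀ a (J : Fin N → ι), w a * (∏ i, w (J i)) * (c a + ∑ i, c (J i)) ^ 2 =
        (w a * c a ^ 2) * (∏ i, w (J i)) +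
        (w a * c a) * (2 * ((∏ i, w (J i)) * ∑ i, c (J i))) +
        w a * ((∏ i, w (J i)) * (∑ i, c (J i)) ^ 2) := fun a J => by ring
    simp only [expand, Finset.sum_add_distrib, ← Finset.mul_sum, ← Finset.sum_mul]
    rw [ih, hw, hc, hprod]
    push_cast
    ring

/-- The vertices and the centre of the `ℓ₁` ball of radius `b`. -/
def l1BallAtom {m : ℕ} (b : ℝ) : Option (Fin m × Bool) → Fin m → ℝ
  | none => 0
  | some (j, s) => Pi.single j (if s then b else -b)

/-- The average of `N` vertices of the `ℓ₁` ball of radius `b`. -/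
def l1BallAverage {m : ℕ} (b : ℝ) (N : ℕ) (J : Fin N → Option (Fin m × Bool)) : Fin m → ℝ :=
  fun j => (N : ℝ)⁻¹ * ∑ i, l1BallAtom b (J i) j

theorem sum_l1BallAtom_none {m : ℕ} (b : ℝ) (x : Fin m → ℝ) :
    ∑ j, l1BallAtom b none j * x j = 0 := by
  simp [l1BallAtom]

theorem sum_l1BallAtom_some {m : ℕ} (b : ℝ) (x : Fin m → ℝ) (j : Fin m) (s : Bool) :
    ∑ i, l1BallAtom b (some (j, s)) i * x i = (if s then b else -b) * x j := by
  simp [l1BallAtom, Pi.single_apply]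

/-- A vertex sees a single coordinate of `x`, so the bound is free of the dimension. -/
theorem sq_sum_l1BallAtom_le {m : ℕ} {b M : ℝ} (x : Fin m → ℝ) (hx : ∀ j, |x j| ≤ M)
    (a : Option (Fin m × Bool)) : (∑ j, l1BallAtom b a j * x j) ^ 2 ≤ (b * M) ^ 2 := by
  rcases a with _ | ⟨j, s⟩
  · rw [sum_l1BallAtom_none, zero_pow two_ne_zero]
    exact sq_nonneg _
  · rw [sum_l1BallAtom_some, mul_pow, mul_pow]
    have : (if s then b else -b) ^ 2 = b ^ 2 := by cases s <;> simp
    rw [this]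
    exact mul_le_mul_of_nonneg_left (sq_le_sq' (abs_le.1 (hx j)).1 (abs_le.1 (hx j)).2)
      (sq_nonneg b)

/-- Every point of an `ℓ₁` ball is a convex combination of its vertices and its centre. -/
theorem exists_weights_l1BallAtom {m : ℕ} {b : ℝ} (hb : 0 ≤ b) (β : Fin m → ℝ)
    (hβ : l1Norm β ≤ b) :
    ∃ w : Option (Fin m × Bool) → ℝ, (∀ a, 0 ≤ w a) ∧ ∑ a, w a = 1 ∧
      ∀ x : Fin m → ℝ, ∑ a, w a * ∑ j, l1BallAtom b a j * x j = ∑ j, β j * x j := by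
  -- Positive and negative parts weight the two signed vertices; the centre takes the mass left
  -- over. If `b = 0`, division by zero gives `0` and all mass sits at the centre.
  refine ⟨fun a => a.elim (1 - l1Norm β / b)
    fun p => (if p.2 then (β p.1)⁺ else (β p.1)⁻) / b, ?_, ?_, ?_⟩
  · rintro (_ | ⟨j, s⟩)
    · exact sub_nonneg.2 (div_le_one_of_le₀ hβ hb)
    · cases s
      · exact div_nonneg (negPart_nonneg _) hb
      · exact div_nonneg (posPart_nonneg _) hb
  · simp only [Fintype.sum_option, Option.elim, Fintype.sum_prod_type, Fintype.sum_bool, if_true,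
      posPart_add_negPart, Bool.false_eq_true, if_false, ← Finset.sum_div]
    simp [l1Norm]
  · intro x
    rcases hb.eq_or_lt with rfl | hb
    · have h0 : ∀ j, β j = 0 := fun j => abs_nonpos_iff.1 <|
        (Finset.single_le_sum (f := fun j => |β j|) (fun _ _ => abs_nonneg _)
          (Finset.mem_univ j)).trans hβ
      simp [h0, Fintype.sum_option, sum_l1BallAtom_none,
        sum_l1BallAtom_some]
    · simp only [Fintype.sum_option, Option.elim, Fintype.sum_prod_type, Fintype.sum_bool, if_true,
        Bool.false_eq_true, if_false, sum_l1BallAtom_none, sum_l1BallAtom_some, mul_zero, zero_add]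
      refine Finset.sum_congr rfl fun j _ => ?_
      have hj := posPart_sub_negPart (β j)
      field_simp
      linear_combination x j * hj

/-- **Maurey's empirical method**: a point of an `ℓ₁` ball is a convex combination of averages of
`N` vertices which approximate it in mean square, against every bounded vector. -/
theorem exists_weights_l1BallAverage {m : ℕ} {b : ℝ} (hb : 0 ≤ b) (β : Fin m → ℝ)
    (hβ : l1Norm β ≤ b) {N : ℕ} (hN : 0 < N) :
    ∃ W : (Fin N → Option (Fin m × Bool)) → ℝ, (∀ J, 0 ≤ W J) ∧ ∑ J, W J = 1 ∧
      ∀ (M : ℝ) (x : Fin m → ℝ), (∀ j, |x j| ≤ M) →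
        ∑ J, W J * (∑ j, l1BallAverage b N J j * x j - ∑ j, β j * x j) ^ 2 ≤ (b * M) ^ 2 / N := by
  obtain ⟨w, hw0, hw1, hw⟩ := exists_weights_l1BallAtom hb β hβ
  -- Product weights: `N` independent draws from `w`.
  refine ⟨fun J => ∏ i, w (J i), fun J => Finset.prod_nonneg fun i _ => hw0 _, ?_, ?_⟩
  · rw [← Fintype.sum_pow, hw1, one_pow]
  intro M x hx
  have hN' : (0 : ℝ) < N := by exact_mod_cast hN
  set t := ∑ j, β j * x j with ht
  set d : Option (Fin m × Bool) → ℝ := fun a => ∑ j, l1BallAtom b a j * x j with hd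
  have havg : ∀ J : Fin N → Option (Fin m × Bool),
      ∑ j, l1BallAverage b N J j * x j - t = (N : ℝ)⁻¹ * ∑ i, (d (J i) - t) := by
    intro J
    simp only [l1BallAverage, hd, Finset.sum_sub_distrib, Finset.sum_const, Finset.card_univ,
      Fintype.card_fin, nsmul_eq_mul, mul_sub, inv_mul_cancel_left₀ hN'.ne']
    congr 1
    rw [Finset.sum_comm, Finset.mul_sum]
    exact Finset.sum_congr rfl fun j _ => by rw [mul_assoc, Finset.sum_mul]
  have hcent : ∑ a, w a * (d a - t) = 0 := by
    simp only [mul_sub, Finset.sum_sub_distrib, ← Finset.sum_mul, hw1, hw, hd, ← ht]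
    ring
  have hvar : ∑ a, w a * (d a - t) ^ 2 ≤ (b * M) ^ 2 := by
    have h1 : ∑ a, w a * (d a - t) ^ 2 = ∑ a, w a * d a ^ 2 - t ^ 2 := by
      have h2 : ∀ a, w a * (d a - t) ^ 2 =
          w a * d a ^ 2 - 2 * t * (w a * (d a - t)) - w a * t ^ 2 := fun a => by ring
      simp only [h2, Finset.sum_sub_distrib, ← Finset.mul_sum, ← Finset.sum_mul, hcent, hw1]
      ring
    calc ∑ a, w a * (d a - t) ^ 2 ≤ ∑ a, w a * d a ^ 2 := by rw [h1]; linarith [sq_nonneg t]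
      _ ≤ ∑ a, w a * (b * M) ^ 2 := Finset.sum_le_sum fun a _ =>
          mul_le_mul_of_nonneg_left (sq_sum_l1BallAtom_le x hx a) (hw0 a)
      _ = (b * M) ^ 2 := by rw [← Finset.sum_mul, hw1, one_mul]
  calc ∑ J : Fin N → Option (Fin m × Bool),
        (∏ i, w (J i)) * (∑ j, l1BallAverage b N J j * x j - t) ^ 2
      = (N : ℝ)⁻¹ ^ 2 * ∑ J : Fin N → Option (Fin m × Bool),
          (∏ i, w (J i)) * (∑ i, (d (J i) - t)) ^ 2 := by
        rw [Finset.mul_sum]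
        exact Finset.sum_congr rfl fun J _ => by rw [havg]; ring
    _ = (∑ a, w a * (d a - t) ^ 2) / N := by
        rw [sum_prod_mul_sq_sum w (fun a => d a - t) hw1 hcent]
        field_simp
    _ ≤ (b * M) ^ 2 / N := by gcongr

/-- A bounded function which varies by at most `ε` at distances below `δ` varies by at most `ε`
plus a multiple of the squared distance. -/
theorem abs_sub_le_add_mul_sq {f : ℝ → ℝ} {C δ ε : ℝ} (hC : ∀ s, |f s| ≤ C) (hδ : 0 < δ)
    (hε : 0 ≤ ε) (hf : ∀ s s', |s - s'| < δ → |f s - f s'| < ε) (s s' : ℝ) :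
    |f s - f s'| ≤ ε + 2 * C / δ ^ 2 * (s - s') ^ 2 := by
  have hC0 : 0 ≤ C := (abs_nonneg _).trans (hC 0)
  rcases lt_or_ge |s - s'| δ with h | h
  · have : 0 ≤ 2 * C / δ ^ 2 * (s - s') ^ 2 := by positivity
    linarith [hf s s' h]
  -- Beyond distance `δ` the quadratic term alone exceeds the full oscillation `2C`.
  · have h1 : 1 ≤ (s - s') ^ 2 / δ ^ 2 := by
      rw [one_le_div (by positivity), ← sq_abs (s - s')]
      gcongr
    have h2 : |f s - f s'| ≤ 2 * C := (abs_sub _ _).trans (by linarith [hC s, hC s'])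
    calc |f s - f s'| ≤ 2 * C * 1 := by linarith
      _ ≤ 2 * C * ((s - s') ^ 2 / δ ^ 2) := by gcongr
      _ ≤ ε + 2 * C / δ ^ 2 * (s - s') ^ 2 := by rw [mul_div_assoc', div_mul_eq_mul_div]; linarith

/-! ### Concentration against the number of averages -/

/-- **Hoeffding's inequality** for the average of i.i.d. copies of a bounded variable. -/
theorem measure_pi_abs_average_sub_integral_le {Ω : Type*} [MeasurableSpace Ω] (μ : Measure Ω)
    [IsProbabilityMeasure μ] {f : Ω → ℝ} (hf : Measurable f) {C : ℝ} (hC0 : 0 < C)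
    (hC : ∀ ω, |f ω| ≤ C) {n : ℕ} (hn : 0 < n) {η : ℝ} (hη : 0 ≤ η) :
    (Measure.pi fun _ : Fin n => μ) {z | η ≤ |(1 / (n : ℝ)) * ∑ i, f (z i) - ∫ ω, f ω ∂μ|} ≤
      ENNReal.ofReal (2 * Real.exp (-(n * η ^ 2 / (2 * C ^ 2)))) := by
  have hn' : (0 : ℝ) < n := by exact_mod_cast hn
  have tail : ∀ g : Ω → ℝ, Measurable g → (∀ ω, |g ω| ≤ C) →
      (Measure.pi fun _ : Fin n => μ).real {z | n * η ≤ ∑ i, (g (z i) - ∫ ω, g ω ∂μ)} ≤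
        Real.exp (-(n * η ^ 2 / (2 * C ^ 2))) := by
    intro g hg hgC
    have hsub := ProbabilityTheory.hasSubgaussianMGF_of_mem_Icc (μ := μ) hg.aemeasurable
      (Eventually.of_forall fun ω => abs_le.1 (hgC ω))
    have hindep := ProbabilityTheory.iIndepFun_pi (μ := fun _ : Fin n => μ)
      (X := fun _ ω => g ω - ∫ ω, g ω ∂μ) fun _ => (hg.sub_const _).aemeasurable
    have hsub' : ∀ i ∈ (Finset.univ : Finset (Fin n)), ProbabilityTheory.HasSubgaussianMGF
        (fun z : Fin n → Ω => g (z i) - ∫ ω, g ω ∂μ) ((‖C - -C‖₊ / 2) ^ 2)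
        (Measure.pi fun _ : Fin n => μ) := by
      intro i _
      have hp := measurePreserving_eval (fun _ : Fin n => μ) i
      refine ProbabilityTheory.HasSubgaussianMGF.of_map (Y := Function.eval i)
        (X := fun ω => g ω - ∫ ω, g ω ∂μ) hp.measurable.aemeasurable ?_
      rwa [hp.map_eq]
    refine (ProbabilityTheory.HasSubgaussianMGF.measure_sum_ge_le_of_iIndepFun hindep hsub'
      (by positivity)).trans_eq ?_
    congr 1
    have hnorm : ‖C - -C‖ / 2 = C := by
      rw [Real.norm_eq_abs, abs_of_pos (by linarith)]
      ring
    simp only [Finset.sum_const, Finset.card_univ, Fintype.card_fin, nsmul_eq_mul, NNReal.coe_mul,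
      NNReal.coe_natCast, NNReal.coe_pow, NNReal.coe_div, coe_nnnorm, NNReal.coe_ofNat, hnorm]
    field_simp
  have hsub : {z : Fin n → Ω | η ≤ |(1 / (n : ℝ)) * ∑ i, f (z i) - ∫ ω, f ω ∂μ|} ⊆
      {z | n * η ≤ ∑ i, (f (z i) - ∫ ω, f ω ∂μ)} ∪
      {z | n * η ≤ ∑ i, ((-f) (z i) - ∫ ω, (-f) ω ∂μ)} := by
    intro z hz
    simp only [Set.mem_ofPred_eq, Set.mem_union, Pi.neg_apply, integral_neg, Finset.sum_sub_distrib,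
      Finset.sum_neg_distrib, Finset.sum_const, Finset.card_univ, Fintype.card_fin,
      nsmul_eq_mul] at hz ⊢
    have h1 : ∑ i, f (z i) - n * ∫ ω, f ω ∂μ =
        n * ((1 / (n : ℝ)) * ∑ i, f (z i) - ∫ ω, f ω ∂μ) := by field_simp
    rcases le_abs'.1 hz with h | h
    · right
      have : n * ((1 / (n : ℝ)) * ∑ i, f (z i) - ∫ ω, f ω ∂μ) ≤ n * -η := by gcongr
      linarith
    · left
      rw [h1]
      gcongr
  refine (measure_mono hsub).trans ?_
  rw [← ENNReal.ofReal_toReal (measure_ne_top (Measure.pi fun _ : Fin n => μ) _)]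
  refine ENNReal.ofReal_le_ofReal ((measureReal_union_le _ _).trans ?_)
  have h1 := tail f hf hC
  have h2 := tail (-f) hf.neg fun ω => by simpa using hC ω
  linarith

/-- Exponential concentration beats the number of averages of `O(k)` out of polynomially many
atoms when `k = o(n / log n)`. -/
theorem tendsto_card_pow_mul_exp_neg {m k : ℕ → ℕ} {α : ℝ}
    (hm : (fun n : ℕ => (m n : ℝ)) =O[atTop] fun n : ℕ => (n : ℝ) ^ α)
    (hk : (fun n : ℕ => (k n : ℝ)) =o[atTop] fun n : ℕ => (n : ℝ) / Real.log n)
    (A : ℕ) {c : ℝ} (hc : 0 < c) :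
    Tendsto (fun n : ℕ => (2 * (m n : ℝ) + 1) ^ (A * k n + 1) * (2 * Real.exp (-(n * c)))) atTop
      (𝓝 0) := by
  have hlog : (fun n : ℕ => Real.log (2 * (m n : ℝ) + 1)) =O[atTop]
      fun n : ℕ => Real.log (n : ℝ) := by
    obtain ⟨K, hK, hmK⟩ := hm.exists_pos
    refine Asymptotics.IsBigO.of_bound (Real.log (2 * K + 1) + |α|) ?_
    filter_upwards [hmK.bound, eventually_ge_atTop 3] with n hn hn3
    have hn3' : (3 : ℝ) ≤ n := by exact_mod_cast hn3
    have hn0 : (0 : ℝ) < n := by linarith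
    have hlogn : 1 ≤ Real.log n := by
      rw [Real.le_log_iff_exp_le hn0]
      linarith [Real.exp_one_lt_d9]
    -- `α` may be negative; with `|α|` the power is at least `1` and absorbs the `+ 1` in `2m + 1`.
    have hpow : (n : ℝ) ^ α ≤ (n : ℝ) ^ |α| :=
      Real.rpow_le_rpow_of_exponent_le (by linarith) (le_abs_self α)
    have hpow1 : 1 ≤ (n : ℝ) ^ |α| := Real.one_le_rpow (by linarith) (abs_nonneg α)
    rw [Real.norm_natCast, Real.norm_of_nonneg (by positivity)] at hn
    have hbound : 2 * (m n : ℝ) + 1 ≤ (2 * K + 1) * (n : ℝ) ^ |α| := by nlinarith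
    have hm1 : (1 : ℝ) ≤ 2 * (m n : ℝ) + 1 := by linarith [(m n).cast_nonneg (α := ℝ)]
    rw [Real.norm_of_nonneg (Real.log_nonneg hm1), Real.norm_of_nonneg (by linarith)]
    calc Real.log (2 * (m n : ℝ) + 1) ≤ Real.log ((2 * K + 1) * (n : ℝ) ^ |α|) :=
          Real.log_le_log (by linarith) hbound
      _ = Real.log (2 * K + 1) + |α| * Real.log n := by
          rw [Real.log_mul (by positivity) (by positivity), Real.log_rpow hn0]
      _ ≤ (Real.log (2 * K + 1) + |α|) * Real.log n := by
          have := Real.log_nonneg (by linarith : (1 : ℝ) ≤ 2 * K + 1)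
          nlinarith
  -- Handles the `+ 1` in the exponent `A * k n + 1`.
  have hone : (fun _ : ℕ => (1 : ℝ)) =o[atTop] fun n : ℕ => (n : ℝ) / Real.log n := by
    have hlogo : (fun n : ℕ => Real.log (n : ℝ)) =o[atTop] fun n : ℕ => (n : ℝ) :=
      Real.isLittleO_log_id_atTop.comp_tendsto tendsto_natCast_atTop_atTop
    refine (hlogo.mul_isBigO
      (Asymptotics.isBigO_refl (fun n : ℕ => (Real.log (n : ℝ))⁻¹) atTop)).congr' ?_ ?_
    · filter_upwards [eventually_ge_atTop 2] with n hn
      have : 0 < Real.log (n : ℝ) := Real.log_pos (by exact_mod_cast hn)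
      exact mul_inv_cancel₀ this.ne'
    · exact Eventually.of_forall fun n => (div_eq_mul_inv _ _).symm
  have hmain : (fun n : ℕ => ((A * k n + 1 : ℕ) : ℝ) * Real.log (2 * (m n : ℝ) + 1)) =o[atTop]
      fun n : ℕ => (n : ℝ) := by
    refine (((hk.const_mul_left (A : ℝ)).add hone).mul_isBigO hlog).congr' ?_ ?_
    · exact Eventually.of_forall fun n => by push_cast; rfl
    · filter_upwards [eventually_ge_atTop 2] with n hn
      have : 0 < Real.log (n : ℝ) := Real.log_pos (by exact_mod_cast hn)
      field_simp
  have hexp : Tendsto (fun n : ℕ => 2 * Real.exp (-((n : ℝ) * (c / 2)))) atTop (𝓝 0) := by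
    have := (Real.tendsto_exp_neg_atTop_nhds_zero.comp
      (tendsto_natCast_atTop_atTop.atTop_mul_const (half_pos hc))).const_mul 2
    simpa using this
  refine squeeze_zero' (Eventually.of_forall fun n => by positivity) ?_ hexp
  -- The count uses up at most half of the exponent `n c`; the other half still decays.
  filter_upwards [hmain.bound (half_pos hc)] with n hn
  have hm1 : (0 : ℝ) < 2 * (m n : ℝ) + 1 := by positivity
  rw [Real.norm_natCast] at hn
  have hn' := (le_abs_self _).trans hn
  rw [← Real.exp_log hm1, ← Real.exp_nat_mul, mul_left_comm, ← Real.exp_add]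
  gcongr
  linarith

/-! ### Sparsity and compactness in `ℓ₁` -/

/-- Cauchy–Schwarz restricted to the support; this puts `βstar` in the constraint ball. -/
theorem l1Norm_le_sqrt_numActive_mul_l2Norm {m : ℕ} (β : Fin m → ℝ) :
    l1Norm β ≤ √(numActive β) * l2Norm β := by
  rw [l1Norm, numActive, l2Norm, ← Real.sqrt_mul (Nat.cast_nonneg _)]
  refine Real.le_sqrt_of_sq_le ?_
  rw [← Finset.sum_filter_add_sum_filter_not Finset.univ (fun j => β j ≠ 0) fun j => |β j|]
  rw [Finset.sum_eq_zero (s := Finset.univ.filter fun j => ¬β j ≠ 0) fun j hj => by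
    simpa using hj, add_zero]
  refine sq_sum_le_card_mul_sum_sq.trans ?_
  simp only [sq_abs]
  gcongr
  exact Finset.filter_subset _ _

theorem isCompact_l1Norm_le {m : ℕ} (b : ℝ) : IsCompact {β : Fin m → ℝ | l1Norm β ≤ b} := by
  have hcont : Continuous (l1Norm (m := m)) := by unfold l1Norm; fun_prop
  refine Metric.isCompact_of_isClosed_isBounded (isClosed_le hcont continuous_const) ?_
  refine isBounded_iff_forall_norm_le.2 ⟨b, fun β hβ => ?_⟩
  have h0 : 0 ≤ l1Norm β := Finset.sum_nonneg fun _ _ => abs_nonneg _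
  exact (pi_norm_le_iff_of_nonneg (h0.trans hβ)).2 fun j =>
    (Finset.single_le_sum (f := fun j => |β j|) (fun _ _ => abs_nonneg _)
      (Finset.mem_univ j)).trans hβ

/-! ### Uniform deviations and empirical risk minimization -/

namespace TriangularArray

variable {𝒴 : Type*} [MeasurableSpace 𝒴] (T : TriangularArray 𝒴)

/-- The empirical risk is continuous in `β`, through finitely many linear forms, and the ball is
compact and contains `0`. -/
theorem exists_isL1ConstrainedERM (hloss : T.UniformlyContinuousLoss) (n : ℕ)
    (z : Fin n → T.Obs n) {b : ℝ} (hb : 0 ≤ b) : ∃ β, T.IsL1ConstrainedERM n z b β := by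
  obtain ⟨h, hh, -, hcont⟩ := hloss
  have hc : ∀ y, Continuous (h n y) := fun y => Metric.continuous_iff.2 fun s ε hε =>
    let ⟨δ, hδ, hd⟩ := hcont ε hε
    ⟨δ, hδ, fun s' hs => hd n y s' s hs⟩
  have hce : Continuous (T.empiricalRisk n z) := by
    unfold empiricalRisk loss
    simp only [hh]
    exact continuous_const.mul (continuous_finsetSum _ fun i _ => (hc _).comp (by fun_prop))
  obtain ⟨β, hβ, hmin⟩ := (isCompact_l1Norm_le (m := T.m n) b).exists_isMinOn
    ⟨0, by simpa [l1Norm] using hb⟩ hce.continuousOn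
  exact ⟨β, hβ, fun β' hβ' => hmin hβ'⟩

variable {T}

/-- The loss of a point of an `ℓ₁` ball is close to a convex combination of the losses of averages
of vertices. -/
theorem exists_weights_abs_loss_sub_le {n : ℕ} {h : 𝒴 → ℝ → ℝ}
    (hh : ∀ β x y, T.l y (T.g n β x) = h y (∑ j, β j * x j)) {C δ ε : ℝ}
    (hC : ∀ y s, |h y s| ≤ C) (hδ : 0 < δ) (hε : 0 ≤ ε)
    (hcont : ∀ y s s', |s - s'| < δ → |h y s - h y s'| < ε) {b : ℝ} (hb : 0 ≤ b)
    {β : Fin (T.m n) → ℝ} (hβ : l1Norm β ≤ b) {N : ℕ} (hN : 0 < N) :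
    ∃ W : (Fin N → Option (Fin (T.m n) × Bool)) → ℝ, (∀ J, 0 ≤ W J) ∧ ∑ J, W J = 1 ∧
      ∀ (M : ℝ) (z : T.Obs n), (∀ j, |z.2 j| ≤ M) →
        |T.loss n β z - ∑ J, W J * T.loss n (l1BallAverage b N J) z| ≤
          ε + 2 * C / δ ^ 2 * ((b * M) ^ 2 / N) := by
  obtain ⟨W, hW0, hW1, hW⟩ := exists_weights_l1BallAverage hb β hβ hN
  refine ⟨W, hW0, hW1, fun M z hz => ?_⟩
  have hC0 : 0 ≤ C := (abs_nonneg _).trans (hC z.1 0)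
  have hdiff : T.loss n β z - ∑ J, W J * T.loss n (l1BallAverage b N J) z =
      ∑ J, W J * (T.loss n β z - T.loss n (l1BallAverage b N J) z) := by
    simp only [mul_sub, Finset.sum_sub_distrib, ← Finset.sum_mul, hW1, one_mul]
  rw [hdiff]
  calc |∑ J, W J * (T.loss n β z - T.loss n (l1BallAverage b N J) z)|
      ≤ ∑ J, W J * (ε + 2 * C / δ ^ 2 *
          (∑ j, l1BallAverage b N J j * z.2 j - ∑ j, β j * z.2 j) ^ 2) := by
        refine (Finset.abs_sum_le_sum_abs _ _).trans (Finset.sum_le_sum fun J _ => ?_)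
        rw [abs_mul, abs_of_nonneg (hW0 J), abs_sub_comm]
        refine mul_le_mul_of_nonneg_left ?_ (hW0 J)
        simp only [loss, hh]
        exact abs_sub_le_add_mul_sq (hC z.1) hδ hε (hcont z.1) _ _
    _ = ε + 2 * C / δ ^ 2 * ∑ J, W J *
          (∑ j, l1BallAverage b N J j * z.2 j - ∑ j, β j * z.2 j) ^ 2 := by
        simp only [mul_add, Finset.sum_add_distrib, ← Finset.sum_mul, hW1, one_mul, Finset.mul_sum]
        congr 1
        exact Finset.sum_congr rfl fun J _ => by ring
    _ ≤ ε + 2 * C / δ ^ 2 * ((b * M) ^ 2 / N) := by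
        gcongr
        exact hW M z.2 hz

theorem integrable_loss {n : ℕ} {C : ℝ} (hC : ∀ β z, |T.loss n β z| ≤ C)
    (F : ProbabilityMeasure (T.Obs n)) (β : Fin (T.m n) → ℝ) :
    Integrable (T.loss n β) (F : Measure (T.Obs n)) :=
  Integrable.of_bound (T.measurable_loss n β).aestronglyMeasurable C
    (Eventually.of_forall fun z => hC β z)

/-- Uniform control of the empirical risk on an `ℓ₁` ball by its control on averages of
vertices. -/
theorem abs_empiricalRisk_sub_risk_le {n : ℕ} (hn : 0 < n) {h : 𝒴 → ℝ → ℝ}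
    (hh : ∀ β x y, T.l y (T.g n β x) = h y (∑ j, β j * x j)) {C δ ε : ℝ}
    (hC : ∀ y s, |h y s| ≤ C) (hδ : 0 < δ) (hε : 0 ≤ ε)
    (hcont : ∀ y s s', |s - s'| < δ → |h y s - h y s'| < ε) {b : ℝ} (hb : 0 ≤ b)
    {N : ℕ} (hN : 0 < N) {M : ℝ} {F : ProbabilityMeasure (T.Obs n)}
    (hF : ∀ᵐ z ∂(F : Measure (T.Obs n)), ∀ j, |z.2 j| ≤ M)
    {z : Fin n → T.Obs n} (hz : ∀ i j, |(z i).2 j| ≤ M) {η : ℝ}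
    (hη : ∀ J, |T.empiricalRisk n z (l1BallAverage b N J) -
      T.risk n F (l1BallAverage b N J)| ≤ η)
    {β : Fin (T.m n) → ℝ} (hβ : l1Norm β ≤ b) :
    |T.empiricalRisk n z β - T.risk n F β| ≤
      2 * (ε + 2 * C / δ ^ 2 * ((b * M) ^ 2 / N)) + η := by
  obtain ⟨W, hW0, hW1, hW⟩ := exists_weights_abs_loss_sub_le hh hC hδ hε hcont hb hβ hN
  set κ := ε + 2 * C / δ ^ 2 * ((b * M) ^ 2 / N) with hκ
  have hn' : (0 : ℝ) < n := by exact_mod_cast hn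
  have hint := integrable_loss (T := T) (C := C) (fun β z => by rw [loss, hh]; exact hC _ _) F
  have hrisk : |T.risk n F β - ∑ J, W J * T.risk n F (l1BallAverage b N J)| ≤ κ := by
    have heq : T.risk n F β - ∑ J, W J * T.risk n F (l1BallAverage b N J) =
        ∫ z, (T.loss n β z - ∑ J, W J * T.loss n (l1BallAverage b N J) z)
          ∂(F : Measure (T.Obs n)) := by
      rw [integral_sub (hint β) (integrable_finsetSum _ fun J _ => (hint _).const_mul _),
        integral_finsetSum _ fun J _ => (hint _).const_mul _]
      simp only [integral_const_mul, risk]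
    rw [heq]
    have := norm_integral_le_of_norm_le_const (μ := (F : Measure (T.Obs n))) (C := κ)
      (f := fun z => T.loss n β z - ∑ J, W J * T.loss n (l1BallAverage b N J) z)
      (hF.mono fun z hz => hW M z hz)
    simpa using this
  have hemp : |T.empiricalRisk n z β - ∑ J, W J * T.empiricalRisk n z (l1BallAverage b N J)|
      ≤ κ := by
    have heq : T.empiricalRisk n z β - ∑ J, W J * T.empiricalRisk n z (l1BallAverage b N J) =
        (1 / (n : ℝ)) * ∑ i, (T.loss n β (z i) -
          ∑ J, W J * T.loss n (l1BallAverage b N J) (z i)) := by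
      simp only [empiricalRisk, Finset.sum_sub_distrib, mul_sub]
      congr 1
      rw [Finset.sum_comm, Finset.mul_sum]
      exact Finset.sum_congr rfl fun J _ => by rw [mul_left_comm, Finset.mul_sum]
    rw [heq, abs_mul, abs_of_pos (by positivity)]
    calc (1 / (n : ℝ)) * |∑ i, (T.loss n β (z i) -
          ∑ J, W J * T.loss n (l1BallAverage b N J) (z i))|
        ≤ (1 / (n : ℝ)) * ∑ i : Fin n, κ := by
          gcongr
          exact (Finset.abs_sum_le_sum_abs _ _).trans
            (Finset.sum_le_sum fun i _ => hW M (z i) (hz i))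
      _ = κ := by
          simp only [Finset.sum_const, Finset.card_univ, Fintype.card_fin, nsmul_eq_mul]
          field_simp
  have hnet : |∑ J, W J * T.empiricalRisk n z (l1BallAverage b N J) -
      ∑ J, W J * T.risk n F (l1BallAverage b N J)| ≤ η := by
    rw [← Finset.sum_sub_distrib]
    simp only [← mul_sub]
    calc |∑ J, W J * (T.empiricalRisk n z (l1BallAverage b N J) -
          T.risk n F (l1BallAverage b N J))| ≤ ∑ J, W J * η := by
          refine (Finset.abs_sum_le_sum_abs _ _).trans (Finset.sum_le_sum fun J _ => ?_)
          rw [abs_mul, abs_of_nonneg (hW0 J)]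
          exact mul_le_mul_of_nonneg_left (hη J) (hW0 J)
      _ = η := by rw [← Finset.sum_mul, hW1, one_mul]
  -- Triangle inequality through the two convex combinations: `κ + η + κ`.
  rw [abs_le] at hrisk hemp hnet ⊢
  constructor <;> linarith [hrisk.1, hrisk.2, hemp.1, hemp.2, hnet.1, hnet.2]

/-- A finite-sample bound on the probability that empirical risk minimization over an `ℓ₁` ball
is not nearly as good as a given point of the ball. -/
theorem measure_lt_risk_sub_risk_le {n : ℕ} (hn : 0 < n) {h : 𝒴 → ℝ → ℝ}
    (hh : ∀ β x y, T.l y (T.g n β x) = h y (∑ j, β j * x j)) {C δ ε : ℝ} (hC0 : 0 < C)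
    (hC : ∀ y s, |h y s| ≤ C) (hδ : 0 < δ) (hε : 0 ≤ ε)
    (hcont : ∀ y s s', |s - s'| < δ → |h y s - h y s'| < ε) {b : ℝ} (hb : 0 ≤ b)
    {N : ℕ} (hN : 0 < N) {M : ℝ} {F : ProbabilityMeasure (T.Obs n)}
    (hF : ∀ᵐ z ∂(F : Measure (T.Obs n)), ∀ j, |z.2 j| ≤ M)
    {βhat : (Fin n → T.Obs n) → Fin (T.m n) → ℝ}
    (hβhat : ∀ z, T.IsL1ConstrainedERM n z b (βhat z))
    {β : Fin (T.m n) → ℝ} (hβ : l1Norm β ≤ b) {η t : ℝ} (hη : 0 ≤ η)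
    (ht : 4 * (ε + 2 * C / δ ^ 2 * ((b * M) ^ 2 / N)) + 2 * η ≤ t) :
    Measure.pi (fun _ : Fin n => (F : Measure (T.Obs n)))
        {z | t < T.risk n F (βhat z) - T.risk n F β} ≤
      ENNReal.ofReal ((2 * (T.m n : ℝ) + 1) ^ N *
        (2 * Real.exp (-(n * (η ^ 2 / (2 * C ^ 2)))))) := by
  set P := Measure.pi (fun _ : Fin n => (F : Measure (T.Obs n))) with hP
  have hdata : ∀ᵐ z ∂P, ∀ i j, |(z i).2 j| ≤ M := ae_all_iff.2 fun i =>
    (measurePreserving_eval (fun _ : Fin n => (F : Measure (T.Obs n))) i).quasiMeasurePreserving.ae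
      hF
  -- The covariates are bounded only almost surely, hence an inclusion up to a null set. The left
  -- event need not be measurable, as `βhat` is arbitrary; monotonicity of the outer measure is
  -- enough.
  have hsub : {z | t < T.risk n F (βhat z) - T.risk n F β} ≤ᵐ[P]
      ⋃ J, {z | η ≤ |T.empiricalRisk n z (l1BallAverage b N J) -
        T.risk n F (l1BallAverage b N J)|} := by
    filter_upwards [hdata] with z hz hlt
    by_contra hcon
    have hη' : ∀ J, |T.empiricalRisk n z (l1BallAverage b N J) -
        T.risk n F (l1BallAverage b N J)| ≤ η := fun J => by
      by_contra hJ
      exact hcon (Set.mem_iUnion.2 ⟨J, (not_le.1 hJ).le⟩)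
    have hdev := abs_empiricalRisk_sub_risk_le hn hh hC hδ hε hcont hb hN hF hz hη' hβ
    have hdev' := abs_empiricalRisk_sub_risk_le hn hh hC hδ hε hcont hb hN hF hz hη'
      (hβhat z).1
    have hmin := (hβhat z).2 β hβ
    have hlt' : t < T.risk n F (βhat z) - T.risk n F β := hlt
    -- The empirical risk of `βhat z` is at most that of `β`, so only two deviations remain, each at
    -- most `2κ + η`, where `κ` is the approximation error.
    linarith [(abs_le.1 hdev).2, (abs_le.1 hdev').1]
  have hbd : ∀ J, P {z | η ≤ |T.empiricalRisk n z (l1BallAverage b N J) -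
      T.risk n F (l1BallAverage b N J)|} ≤
      ENNReal.ofReal (2 * Real.exp (-(n * (η ^ 2 / (2 * C ^ 2))))) := fun J => by
    rw [← mul_div_assoc]
    exact measure_pi_abs_average_sub_integral_le (F : Measure (T.Obs n))
      (T.measurable_loss n (l1BallAverage b N J)) hC0
      (fun z => by rw [hh]; exact hC _ _) hn hη
  calc P {z | t < T.risk n F (βhat z) - T.risk n F β}
      ≤ ∑ J, P {z | η ≤ |T.empiricalRisk n z (l1BallAverage b N J) -
          T.risk n F (l1BallAverage b N J)|} :=
        (measure_mono_ae hsub).trans (measure_iUnion_fintype_le _ _)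
    _ ≤ ∑ _J : Fin N → Option (Fin (T.m n) × Bool),
          ENNReal.ofReal (2 * Real.exp (-(n * (η ^ 2 / (2 * C ^ 2))))) :=
        Finset.sum_le_sum fun J _ => hbd J
    _ = ENNReal.ofReal ((2 * (T.m n : ℝ) + 1) ^ N *
        (2 * Real.exp (-(n * (η ^ 2 / (2 * C ^ 2)))))) := by
        rw [ENNReal.ofReal_mul (by positivity : (0 : ℝ) ≤ (2 * (T.m n : ℝ) + 1) ^ N)]
        simp only [Finset.sum_const, Finset.card_univ, Fintype.card_fun, Fintype.card_option,
          Fintype.card_prod, Fintype.card_fin, Fintype.card_bool, nsmul_eq_mul]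
        congr 1
        rw [← ENNReal.ofReal_natCast]
        push_cast
        rw [mul_comm (T.m n : ℝ) 2]

end TriangularArray

end

theorem theorem2 {𝒴 : Type*} [MeasurableSpace 𝒴] (T : TriangularArray 𝒴)
    (α : ℝ) (hm : (fun n : ℕ => (T.m n : ℝ)) =O[atTop] fun n : ℕ => (n : ℝ) ^ α)
    (hloss : T.UniformlyContinuousLoss)
    (hX : T.BoundedCovariates)
    (k : ℕ → ℕ)
    (hk : (fun n : ℕ => (k n : ℝ)) =o[atTop] fun n : ℕ => (n : ℝ) / Real.log n)
    (R : ℝ) (hR : 0 ≤ R)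
    (βstar : (n : ℕ) → ProbabilityMeasure (T.Obs n) → (Fin (T.m n) → ℝ))
    (hbest : ∀ n, ∀ F ∈ T.𝓕 n, T.IsBest n F (βstar n F))
    (hsparse : ∀ n, ∀ F ∈ T.𝓕 n, numActive (βstar n F) ≤ k n)
    (hnorm : ∀ n, ∀ F ∈ T.𝓕 n, l2Norm (βstar n F) ≤ R) :
    (∀ (n : ℕ) (z : Fin n → T.Obs n), ∃ β, T.IsL1ConstrainedERM n z (R * √(k n)) β) ∧
    ∀ βtilde : T.Procedure,
      (∀ (n : ℕ) (z : Fin n → T.Obs n),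
        T.IsL1ConstrainedERM n z (R * √(k n)) (βtilde n z)) →
      T.Persistent βstar βtilde := by
  refine ⟨fun n z => T.exists_isL1ConstrainedERM hloss n z (by positivity), ?_⟩
  intro βtilde hβtilde t ht
  obtain ⟨h, hh, ⟨C₀, hC₀⟩, hcont⟩ := hloss
  obtain ⟨M, hM⟩ := hX
  obtain ⟨C, hC0, hC⟩ : ∃ C : ℝ, 0 < C ∧ ∀ n y s, |h n y s| ≤ C :=
    ⟨max C₀ 1, by positivity, fun n y s => (hC₀ n y s).trans (le_max_left _ _)⟩
  -- Error budget with `η = t / 6`: `4 * (t/12 + t/12) + 2 * (t/6) = t`.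
  obtain ⟨δ, hδ, hδcont⟩ := hcont (t / 12) (by positivity)
  -- `A` is independent of `n` because `(R√k)²` and `N = A k + 1` both grow linearly in `k`; the `+
  -- 1` keeps `N` positive when `k n = 0`.
  obtain ⟨A, hA⟩ := exists_nat_gt (2 * C / δ ^ 2 * (R * M) ^ 2 / (t / 12))
  have hA0 : (0 : ℝ) < A := lt_of_le_of_lt (by positivity) hA
  rw [div_lt_iff₀ (by positivity)] at hA
  have happrox : ∀ n, 2 * C / δ ^ 2 * ((R * √(k n) * M) ^ 2 / ((A * k n + 1 : ℕ) : ℝ)) ≤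
      t / 12 := by
    intro n
    have hsq : (R * √(k n) * M) ^ 2 = (R * M) ^ 2 * k n := by
      rw [mul_right_comm, mul_pow, Real.sq_sqrt (Nat.cast_nonneg _)]
    rw [hsq, ← mul_div_assoc, div_le_iff₀ (by positivity), ← mul_assoc]
    push_cast
    have := mul_le_mul_of_nonneg_right hA.le (Nat.cast_nonneg (α := ℝ) (k n))
    nlinarith
  have hlim := ENNReal.tendsto_ofReal (tendsto_card_pow_mul_exp_neg hm hk A
    (c := (t / 6) ^ 2 / (2 * C ^ 2)) (by positivity))
  rw [ENNReal.ofReal_zero] at hlim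
  refine tendsto_of_tendsto_of_tendsto_of_le_of_le' tendsto_const_nhds hlim
    (Eventually.of_forall fun n => zero_le) ?_
  filter_upwards [eventually_gt_atTop 0] with n hn
  refine iSup₂_le fun F hF => ?_
  have hβ : l1Norm (βstar n F) ≤ R * √(k n) := by
    refine (l1Norm_le_sqrt_numActive_mul_l2Norm _).trans ?_
    rw [mul_comm]
    gcongr
    · exact hnorm n F hF
    · exact hsparse n F hF
  exact TriangularArray.measure_lt_risk_sub_risk_le hn (hh n) hC0 (hC n) hδ (by positivity)
    (hδcont n) (by positivity) (Nat.succ_pos _) (hM n F hF) (hβtilde n) hβ (by positivity)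
    (by linarith [happrox n])
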